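/- Let $k\ge 1$ be an integer and let $I=[a,b]\subset\mathbb{R}$ be a compact interval. Let $f$ and $g$ be real functions that are real analytic on an open interval containing $I$ and are $k$-independent on $I$, meaning that their $k$-th derivatives $f^{(k)}$ and $g^{(k)}$ are linearly independent over $\mathbb{R}$ as functions on $I$. For finite $B\subset\mathbb{R}$ and $s\ge 1$ write $sB=\{b_1+\dots+b_s : b_1,\dots,b_s\in B\}$, and for finite sets $B,C\subset\mathbb{R}$ write $B\pm C=\{x\pm y : x\in B,\ y\in C\}$. Then there is a constant $c>0$, depending only on $f,g,k,I$, such that for every finite set $A\subset I$ and every real $K$ with $|A+A-A|=K|A|$, $$\bigl|2^{k}f(A)-(2^{k}-1)f(A)\bigr|\cdot\bigl|2^{k}g(A)-(2^{k}-1)g(A)\bigr| \;\ge\; c\,\frac{|A|^{5\cdot 2^{k-1}-2}}{|A+A-A|^{5\cdot 2^{k-1}-2k-3}} \;=\; c\,\frac{|A|^{2k+1}}{K^{5\cdot 2^{k-1}-2k-3}},$$ where for $A=\emptyset$ both fractions are read as $0$. -/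

import Mathlib

open scoped Pointwise

noncomputable section

/-- The `s`-fold sum set `sA = {a₁ + ⋯ + a_s : a₁, …, a_s ∈ A}` (not the dilate of `A` by `s`). -/
def iteratedSumset (s : ℕ) (A : Finset ℝ) : Finset ℝ :=
  (Fintype.piFinset (fun _ : Fin s => A)).image (fun a => ∑ i, a i)

/-- A family `F` of real functions is `k`-independent on `I` if every member is analytic on a
neighbourhood of `I` and the `k`-th derivatives, as functions on `I`, are linearly independent
over the reals. -/
def KIndependent {ι : Type*} (k : ℕ) (I : Set ℝ) (F : ι → ℝ → ℝ) : Prop :=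
  (∀ i, AnalyticOnNhd ℝ (F i) I) ∧
    LinearIndependent ℝ (fun i (x : I) => iteratedDeriv k (F i) (x : ℝ))

end

/-! The combinatorial core is an induction on `k` for pairs whose iterated differences are monotonic
(`DifferenceRegular.exists_card_pow_le`). Group the points of `A` by the distance `d` to their
successor, and let `Δ f` be the difference of `f` with step `d`. Say `f` is increasing. An element
of `2ⁿΔ - (2ⁿ - 1)Δ` lying between the extreme values of `Δ f` on part of a class can be added to `f
w`. The sum stays in `(f w, f (w + d)]` as soon as the difference at `w` dominates those values.
These intervals are disjoint, so the counts for all `d` and `w` add up inside the next balanced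
sumset of `f(A)` (`sum_card_mul_clippedCard_le`). Doing the same for `g`, Cauchy-Schwarz reduces the
product to the pairs `(Δ f, Δ g)` (`pow_le_of_sum_le`). Restricting to popular gaps
(`exists_popular_gaps`) keeps the classes large in terms of `|A + A - A|`. The base case
`card_pow_three_le` runs the squeezing on `f(A)` with the function `g ∘ f⁻¹`.

The analytic input is that `f` and `g` become such a pair once finitely many points are removed:
zeros of derivatives up to order `k` and zeros of the Wronskian of `f^(k)`, `g^(k)`. The quotient
`g^(k) / f^(k)` is then strictly monotonic on each remaining interval, and taking a difference turns
it into a chord slope, which is again monotonic (`differenceRegular_of_hasDerivAt`). One of these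
intervals contains a positive proportion of `A`, unless `A` has bounded size. -/

open scoped Pointwise

/-! ### Balanced sumsets and clipping -/

/-- `2ⁿX - (2ⁿ - 1)X`. -/
noncomputable def balancedSumset (n : ℕ) (X : Finset ℝ) : Finset ℝ := 2 ^ n • X - (2 ^ n - 1) • X

/-- The elements of `Q` lying between the least and the greatest element of `X`. -/
noncomputable def clip (X Q : Finset ℝ) : Finset ℝ :=
  open Classical in Q.filter fun z => (∃ x ∈ X, x ≤ z) ∧ ∃ y ∈ X, z ≤ y

/-- The number of elements of `2ⁿX - (2ⁿ - 1)X` between the least and greatest elements of `X`. -/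
noncomputable def clippedCard (n : ℕ) (X : Finset ℝ) : ℕ := (clip X (balancedSumset n X)).card

/-- The elements of `X` whose successor in `X` lies at distance `d`. -/
noncomputable def gapClass (X : Finset ℝ) (d : ℝ) : Finset ℝ :=
  open Classical in X.filter fun x => x + d ∈ X ∧ ∀ y ∈ X, y ≤ x ∨ x + d ≤ y

theorem mem_clip {X Q : Finset ℝ} {z : ℝ} :
    z ∈ clip X Q ↔ z ∈ Q ∧ (∃ x ∈ X, x ≤ z) ∧ ∃ y ∈ X, z ≤ y := by
  simp [clip]

theorem mem_gapClass {X : Finset ℝ} {d x : ℝ} :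
    x ∈ gapClass X d ↔ x ∈ X ∧ x + d ∈ X ∧ ∀ y ∈ X, y ≤ x ∨ x + d ≤ y := by
  simp [gapClass]

theorem iteratedSumset_eq_nsmul (s : ℕ) (A : Finset ℝ) : iteratedSumset s A = s • A := by
  ext x
  simp only [iteratedSumset, Finset.mem_image, Fintype.mem_piFinset, Finset.mem_nsmul,
    List.sum_ofFn]
  constructor
  · rintro ⟨a, ha, rfl⟩
    exact ⟨fun i => ⟨a i, ha i⟩, rfl⟩
  · rintro ⟨a, rfl⟩
    exact ⟨fun i => a i, fun i => (a i).2, rfl⟩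

theorem two_pow_split (n : ℕ) : ∃ q : ℕ, 2 ^ n = q + 1 ∧ 2 ^ n - 1 = q :=
  ⟨2 ^ n - 1, by have := Nat.one_le_two_pow (n := n); omega, rfl⟩

theorem mem_balancedSumset_self (n : ℕ) {X : Finset ℝ} {x : ℝ} (hx : x ∈ X) :
    x ∈ balancedSumset n X := by
  obtain ⟨q, h1, h2⟩ := two_pow_split n
  rw [balancedSumset, h2, h1]
  refine Finset.mem_sub.2 ⟨_, Finset.nsmul_mem_nsmul hx, _, Finset.nsmul_mem_nsmul hx, ?_⟩
  rw [add_nsmul]; simp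

theorem balancedSumset_neg (n : ℕ) (X : Finset ℝ) :
    balancedSumset n (-X) = -balancedSumset n X := by
  rw [balancedSumset, balancedSumset, neg_nsmul, neg_nsmul]
  simp only [sub_eq_add_neg, neg_add]

/-- With `q = 2ⁿ - 1`, expanding `B + (q + 1)(B - B) - q(B - B)` uses `1 + (q + 1) + q = 2ⁿ⁺¹`
positive and `2q + 1 = 2ⁿ⁺¹ - 1` negative copies of `B`. This doubling is the origin of the powers
of two. -/
theorem add_mem_balancedSumset_succ {n : ℕ} {B C : Finset ℝ} (hC : C ⊆ B - B) {x y : ℝ}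
    (hx : x ∈ B) (hy : y ∈ balancedSumset n C) : x + y ∈ balancedSumset (n + 1) B := by
  obtain ⟨q, h1, h2⟩ := two_pow_split n
  have h3 : 2 ^ (n + 1) = 1 + (q + 1) + q := by rw [pow_succ, h1]; ring
  have h4 : 2 ^ (n + 1) - 1 = (q + 1) + q := by omega
  have key : balancedSumset (n + 1) B = B + (((q + 1) • (B - B)) - q • (B - B)) := by
    rw [balancedSumset, h3, Nat.add_assoc 1, Nat.add_sub_cancel_left, nsmul_sub, nsmul_sub]
    simp only [add_nsmul, one_nsmul, sub_eq_add_neg, neg_add, neg_neg]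
    ac_rfl
  rw [key]
  refine Finset.add_mem_add hx ?_
  rw [balancedSumset, h1, Nat.add_sub_cancel] at hy
  exact Finset.sub_subset_sub (Finset.nsmul_subset_nsmul_left hC)
    (Finset.nsmul_subset_nsmul_left hC) hy

theorem balancedSumset_one (X : Finset ℝ) : balancedSumset 1 X = X + X - X := by
  simp [balancedSumset, two_nsmul]

theorem self_subset_clip_balancedSumset (n : ℕ) (X : Finset ℝ) :
    X ⊆ clip X (balancedSumset n X) := fun x hx =>
  mem_clip.2 ⟨mem_balancedSumset_self n hx, ⟨x, hx, le_rfl⟩, x, hx, le_rfl⟩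

theorem card_le_clippedCard (n : ℕ) (X : Finset ℝ) : X.card ≤ clippedCard n X :=
  Finset.card_le_card (self_subset_clip_balancedSumset n X)

theorem clippedCard_le (n : ℕ) (X : Finset ℝ) : clippedCard n X ≤ (balancedSumset n X).card :=
  Finset.card_le_card fun _ hz => (mem_clip.1 hz).1

theorem clip_neg (X Q : Finset ℝ) : clip (-X) (-Q) = -clip X Q := by
  ext z
  simp only [mem_clip, Finset.mem_neg']
  constructor
  · rintro ⟨h, ⟨x, hx, hxz⟩, y, hy, hzy⟩
    exact ⟨h, ⟨-y, hy, by linarith⟩, -x, hx, by linarith⟩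
  · rintro ⟨h, ⟨x, hx, hxz⟩, y, hy, hzy⟩
    exact ⟨h, ⟨-y, by simpa using hy, by linarith⟩, -x, by simpa using hx, by linarith⟩

theorem clippedCard_neg (n : ℕ) (X : Finset ℝ) : clippedCard n (-X) = clippedCard n X := by
  rw [clippedCard, balancedSumset_neg, clip_neg, Finset.card_neg, clippedCard]

theorem image_neg_fun (A : Finset ℝ) (f : ℝ → ℝ) : A.image (fun x => -f x) = -A.image f := by
  rw [← Finset.image_neg_eq_neg, Finset.image_image]; rfl

/-- Sets squeezed into pairwise disjoint intervals with endpoints in `X`. -/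
theorem sum_card_le_card_clip {ι : Type*} (s : Finset ι) (X Q : Finset ℝ) (p q : ι → ℝ)
    (V : ι → Finset ℝ) (hp : ∀ i ∈ s, p i ∈ X) (hq : ∀ i ∈ s, q i ∈ X)
    (hV : ∀ i ∈ s, ∀ v ∈ V i, v ∈ Q ∧ p i < v ∧ v ≤ q i)
    (hdisj : ∀ i ∈ s, ∀ j ∈ s, i ≠ j → q i ≤ p j ∨ q j ≤ p i) :
    ∑ i ∈ s, (V i).card ≤ (clip X Q).card := by
  classical
  rw [← Finset.card_biUnion]
  · refine Finset.card_le_card fun z hz => ?_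
    obtain ⟨i, hi, hz⟩ := Finset.mem_biUnion.1 hz
    obtain ⟨h1, h2, h3⟩ := hV i hi z hz
    exact mem_clip.2 ⟨h1, ⟨_, hp i hi, h2.le⟩, _, hq i hi, h3⟩
  · intro i hi j hj hij
    refine Finset.disjoint_left.2 fun z hzi hzj => ?_
    obtain ⟨-, h2, h3⟩ := hV i hi z hzi
    obtain ⟨-, h4, h5⟩ := hV j hj z hzj
    rcases hdisj i hi j hj hij with h | h <;> linarith

/-! ### Gaps between consecutive points -/

theorem gapClass_subset (X : Finset ℝ) (d : ℝ) : gapClass X d ⊆ X :=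
  fun _ h => (mem_gapClass.1 h).1

/-- Distinct pairs (gap, left endpoint) belong to non-overlapping intervals. -/
theorem gap_intervals_disjoint {X : Finset ℝ} {d d' x x' : ℝ} (hd : 0 < d) (hd' : 0 < d')
    (hx : x ∈ gapClass X d) (hx' : x' ∈ gapClass X d') (hne : d = d' → x ≠ x') :
    x + d ≤ x' ∨ x' + d' ≤ x := by
  obtain ⟨h1, h2, h3⟩ := mem_gapClass.1 hx
  obtain ⟨h1', h2', h3'⟩ := mem_gapClass.1 hx'
  rcases h3 x' h1' with h | h
  · rcases h3' x h1 with h' | h'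
    · obtain rfl : x = x' := le_antisymm h' h
      exfalso
      refine hne ?_ rfl
      rcases h3 _ h2' with h4 | h4 <;> rcases h3' _ h2 with h5 | h5 <;> linarith
    · exact Or.inr h'
  · exact Or.inl h

theorem exists_successor_gap {X : Finset ℝ} {x y : ℝ} (hx : x ∈ X) (hy : y ∈ X) (hxy : x < y) :
    ∃ d, 0 < d ∧ x ∈ gapClass X d := by
  have hne : (X.filter (x < ·)).Nonempty := ⟨y, Finset.mem_filter.2 ⟨hy, hxy⟩⟩
  have hm := Finset.mem_filter.1 ((X.filter (x < ·)).min'_mem hne)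
  refine ⟨(X.filter (x < ·)).min' hne - x, sub_pos.2 hm.2, mem_gapClass.2 ⟨hx, ?_, fun z hz => ?_⟩⟩
  · simpa using hm.1
  · rcases le_or_gt z x with h | h
    · exact Or.inl h
    · refine Or.inr ?_
      have := (X.filter (x < ·)).min'_le z (Finset.mem_filter.2 ⟨hz, h⟩)
      linarith

/-- A quarter of all points is followed by one of few gaps. -/
theorem exists_few_gaps (X : Finset ℝ) (hX : 2 ≤ X.card) :
    ∃ D : Finset ℝ, (∀ d ∈ D, 0 < d) ∧
      (D.card : ℝ) * X.card ≤ 4 * (clip X (X + X - X)).card ∧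
      (X.card : ℝ) ≤ 4 * ∑ d ∈ D, ((gapClass X d).card : ℝ) := by
  classical
  have hne : X.Nonempty := Finset.card_pos.1 (by omega)
  set X' := X.erase (X.max' hne) with hX'
  have hX'card : X'.card + 1 = X.card := Finset.card_erase_add_one (X.max'_mem hne)
  have hgap : ∀ x ∈ X', ∃ d, 0 < d ∧ x ∈ gapClass X d := fun x hx =>
    exists_successor_gap (Finset.mem_of_mem_erase hx) (X.max'_mem hne)
      (lt_of_le_of_ne (X.le_max' _ (Finset.mem_of_mem_erase hx)) (Finset.ne_of_mem_erase hx))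
  choose! gap hgap0 hgapm using hgap
  set E := X'.image gap with hE
  have hE0 : ∀ d ∈ E, 0 < d := by
    intro d hd
    obtain ⟨x, hx, rfl⟩ := Finset.mem_image.1 hd
    exact hgap0 x hx
  set rank : ℝ → ℕ := fun d => (E.filter (· ≤ d)).card with hrank
  set T := (clip X (X + X - X)).card with hT
  -- Every gap length `d ≤ gap x` gives a point `x + d` of `X + X - X` in `(x, x + gap x]`, and
  -- these intervals are disjoint.
  have hsum : ∑ x ∈ X', rank (gap x) ≤ T := by
    have := sum_card_le_card_clip X' X (X + X - X) id (fun x => x + gap x)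
      (fun x => (E.filter (· ≤ gap x)).image (x + ·))
      (fun x hx => Finset.mem_of_mem_erase hx)
      (fun x hx => (mem_gapClass.1 (hgapm x hx)).2.1) ?_ ?_
    · refine le_trans (le_of_eq (Finset.sum_congr rfl fun x _ => ?_)) this
      rw [Finset.card_image_of_injective _ (add_right_injective x)]
    · intro x hx v hv
      obtain ⟨d, hd, rfl⟩ := Finset.mem_image.1 hv
      obtain ⟨hdE, hdx⟩ := Finset.mem_filter.1 hd
      obtain ⟨z, hz, rfl⟩ := Finset.mem_image.1 hdE
      refine ⟨?_, ?_, ?_⟩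
      · have h := Finset.sub_mem_sub (Finset.add_mem_add (Finset.mem_of_mem_erase hx)
          (mem_gapClass.1 (hgapm z hz)).2.1) (Finset.mem_of_mem_erase hz)
        convert h using 1
        ring
      · have := hgap0 z hz
        simp only [id]; linarith
      · linarith
    · intro x hx y hy hxy
      exact gap_intervals_disjoint (hgap0 x hx) (hgap0 y hy) (hgapm x hx) (hgapm y hy)
        fun _ => hxy
  have hrank1 : ∀ x ∈ X', 1 ≤ rank (gap x) := fun x hx =>
    Finset.card_pos.2 ⟨gap x, Finset.mem_filter.2 ⟨Finset.mem_image_of_mem _ hx, le_rfl⟩⟩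
  have hTpos : X'.card ≤ T := by
    refine le_trans ?_ hsum
    simpa using Finset.card_nsmul_le_sum X' (fun x => rank (gap x)) 1 hrank1
  have hN1 : (1 : ℝ) ≤ X'.card := by exact_mod_cast (by omega : 1 ≤ X'.card)
  have hN : (X.card : ℝ) = X'.card + 1 := by exact_mod_cast hX'card.symm
  have hT1 : (1 : ℝ) ≤ T := hN1.trans (by exact_mod_cast hTpos)
  -- Twice the average bound on the rank: by Markov at most half of `X'` has rank above `R`, while
  -- at most `R` gaps have rank up to `R`.
  set R : ℝ := 2 * T / X'.card with hR
  have hRN : R * X'.card = 2 * T := by rw [hR]; field_simp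
  have hR0 : 0 < R := by positivity
  set D := E.filter (fun d => (rank d : ℝ) ≤ R) with hD
  have hDcard : (D.card : ℝ) ≤ R := by
    rcases D.eq_empty_or_nonempty with h | h
    · simpa [h] using hR0.le
    · have hm := Finset.mem_filter.1 (D.max'_mem h)
      refine le_trans ?_ hm.2
      exact_mod_cast Finset.card_le_card fun d hd =>
        Finset.mem_filter.2 ⟨(Finset.mem_filter.1 hd).1, D.le_max' d hd⟩
  refine ⟨D, fun d hd => hE0 d (Finset.mem_filter.1 hd).1, ?_, ?_⟩
  · rw [hN]
    nlinarith
  · set G := X'.filter (fun x => (rank (gap x) : ℝ) ≤ R) with hG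
    set B := X'.filter (fun x => ¬ (rank (gap x) : ℝ) ≤ R) with hB
    have hGB : G.card + B.card = X'.card := Finset.card_filter_add_card_filter_not _
    have hBT : R * B.card ≤ T := by
      have h1 : B.card • R ≤ ∑ x ∈ B, (rank (gap x) : ℝ) :=
        Finset.card_nsmul_le_sum _ _ _ fun x hx => (not_le.1 (Finset.mem_filter.1 hx).2).le
      have h2 : ∑ x ∈ B, (rank (gap x) : ℝ) ≤ ∑ x ∈ X', (rank (gap x) : ℝ) :=
        Finset.sum_le_sum_of_subset_of_nonneg (Finset.filter_subset _ _) fun _ _ _ => by positivity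
      have h3 : ∑ x ∈ X', (rank (gap x) : ℝ) ≤ T := by exact_mod_cast hsum
      rw [nsmul_eq_mul] at h1
      linarith
    have hB2 : 2 * (B.card : ℝ) ≤ X'.card := by
      by_contra hcon
      have := mul_lt_mul_of_pos_left (not_le.1 hcon) hR0
      linarith
    have hGs : G.card ≤ ∑ d ∈ D, (gapClass X d).card := by
      refine le_trans (Finset.card_le_card fun x hx => ?_) Finset.card_biUnion_le
      obtain ⟨h1, h2⟩ := Finset.mem_filter.1 hx
      exact Finset.mem_biUnion.2 ⟨gap x, Finset.mem_filter.2 ⟨Finset.mem_image_of_mem _ h1, h2⟩,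
        hgapm x h1⟩
    have hGs' : (G.card : ℝ) ≤ ∑ d ∈ D, ((gapClass X d).card : ℝ) := by exact_mod_cast hGs
    have hGB' : (G.card : ℝ) + B.card = X'.card := by exact_mod_cast hGB
    rw [hN]
    linarith

/-- An eighth of all points is followed by one of the popular gaps. -/
theorem exists_popular_gaps (X : Finset ℝ) (hX : 2 ≤ X.card) :
    ∃ D : Finset ℝ, (∀ d ∈ D, 0 < d) ∧
      (X.card : ℝ) ≤ 8 * ∑ d ∈ D, ((gapClass X d).card : ℝ) ∧
      ∀ d ∈ D, (X.card : ℝ) ^ 2 ≤ 32 * (clip X (X + X - X)).card * (gapClass X d).card := by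
  classical
  obtain ⟨D, hD0, hDT, hDs⟩ := exists_few_gaps X hX
  set N : ℝ := (X.card : ℝ) with hN
  set T : ℝ := ((clip X (X + X - X)).card : ℝ) with hT
  have hN2 : 2 ≤ N := by rw [hN]; exact_mod_cast hX
  have hT0 : 0 < T := by
    have : X.card ≤ (clip X (X + X - X)).card := by
      rw [← balancedSumset_one]; exact card_le_clippedCard 1 X
    have : N ≤ T := by rw [hN, hT]; exact_mod_cast this
    linarith
  -- The discarded classes together have at most `|D| N² / (32T) ≤ N / 8` points.
  refine ⟨D.filter fun d => N ^ 2 ≤ 32 * T * (gapClass X d).card,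
    fun d hd => hD0 d (Finset.mem_filter.1 hd).1, ?_, fun d hd => (Finset.mem_filter.1 hd).2⟩
  have hsplit := Finset.sum_filter_add_sum_filter_not D
    (fun d => N ^ 2 ≤ 32 * T * ((gapClass X d).card : ℝ)) fun d => ((gapClass X d).card : ℝ)
  have hrest : ∑ d ∈ D.filter (fun d => ¬ N ^ 2 ≤ 32 * T * ((gapClass X d).card : ℝ)),
      ((gapClass X d).card : ℝ) ≤ N / 8 := by
    have h1 : ∑ d ∈ D.filter (fun d => ¬ N ^ 2 ≤ 32 * T * ((gapClass X d).card : ℝ)),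
        ((gapClass X d).card : ℝ) ≤ (D.filter (fun d =>
          ¬ N ^ 2 ≤ 32 * T * ((gapClass X d).card : ℝ))).card • (N ^ 2 / (32 * T)) := by
      refine Finset.sum_le_card_nsmul _ _ _ fun d hd => ?_
      rw [le_div_iff₀ (by positivity)]
      have := (Finset.mem_filter.1 hd).2
      linarith
    have h2 : ((D.filter (fun d => ¬ N ^ 2 ≤ 32 * T * ((gapClass X d).card : ℝ))).card : ℝ)
        ≤ D.card := by exact_mod_cast Finset.card_filter_le _ _
    rw [nsmul_eq_mul] at h1
    have h3 : (D.card : ℝ) * (N ^ 2 / (32 * T)) ≤ N / 8 := by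
      rw [← mul_div_assoc, div_le_div_iff₀ (by positivity) (by norm_num)]
      nlinarith
    have h4 : 0 ≤ N ^ 2 / (32 * T) := by positivity
    nlinarith
  linarith

/-- Every finite set contains three successive parts, each with at least a third of the points. -/
theorem exists_thirds (X : Finset ℝ) : ∃ L M U : Finset ℝ, L ⊆ X ∧ M ⊆ X ∧ U ⊆ X ∧
    (∀ l ∈ L, ∀ m ∈ M, l ≤ m) ∧ (∀ m ∈ M, ∀ u ∈ U, m ≤ u) ∧
    X.card ≤ 3 * L.card ∧ X.card ≤ 3 * M.card ∧ X.card ≤ 3 * U.card := by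
  obtain ⟨n, hn⟩ : ∃ n, X.card = n := ⟨_, rfl⟩
  rcases Nat.eq_zero_or_pos n with rfl | hpos
  · exact ⟨∅, ∅, ∅, by simp [hn]⟩
  set e := X.orderEmbOfFin hn
  have he : ∀ i, e i ∈ X := X.orderEmbOfFin_mem hn
  -- Neighbouring parts share the points with indices `i` and `j`; weak inequalities between the
  -- parts suffice.
  set i : Fin n := ⟨(n - 1) / 3, by omega⟩ with hi
  set j : Fin n := ⟨n - 1 - (n - 1) / 3, by omega⟩ with hj
  have hsub : ∀ s : Finset (Fin n), s.map e.toEmbedding ⊆ X := by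
    intro s x hx
    obtain ⟨k, -, rfl⟩ := Finset.mem_map.1 hx
    exact he k
  refine ⟨(Finset.Iic i).map e.toEmbedding, (Finset.Icc i j).map e.toEmbedding,
    (Finset.Ici j).map e.toEmbedding, hsub _, hsub _, hsub _, ?_, ?_, ?_, ?_, ?_⟩
  · intro l hl m hm
    obtain ⟨a, ha, rfl⟩ := Finset.mem_map.1 hl
    obtain ⟨b, hb, rfl⟩ := Finset.mem_map.1 hm
    exact e.monotone ((Finset.mem_Iic.1 ha).trans (Finset.mem_Icc.1 hb).1)
  · intro l hl m hm
    obtain ⟨a, ha, rfl⟩ := Finset.mem_map.1 hl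
    obtain ⟨b, hb, rfl⟩ := Finset.mem_map.1 hm
    exact e.monotone ((Finset.mem_Icc.1 ha).2.trans (Finset.mem_Ici.1 hb))
  · rw [Finset.card_map, Fin.card_Iic, hn, hi]; dsimp only; omega
  · rw [Finset.card_map, Fin.card_Icc, hn, hi, hj]; dsimp only; omega
  · rw [Finset.card_map, Fin.card_Ici, hn, hj]; dsimp only; omega

/-! ### Squeezing differences into gaps -/

/-- The forward difference `x ↦ f (x + d) - f x`. -/
def forwardDiff (d : ℝ) (f : ℝ → ℝ) (x : ℝ) : ℝ := f (x + d) - f x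

theorem forwardDiff_neg (d : ℝ) (f : ℝ → ℝ) :
    forwardDiff d (fun x => -f x) = fun x => -forwardDiff d f x := by
  funext x; simp only [forwardDiff]; ring

theorem image_forwardDiff_subset {A B : Finset ℝ} {d : ℝ} (f : ℝ → ℝ) (hB : B ⊆ gapClass A d) :
    B.image (forwardDiff d f) ⊆ A.image f - A.image f := by
  intro y hy
  obtain ⟨x, hx, rfl⟩ := Finset.mem_image.1 hy
  obtain ⟨h1, h2, -⟩ := mem_gapClass.1 (hB hx)
  exact Finset.sub_mem_sub (Finset.mem_image_of_mem f h2) (Finset.mem_image_of_mem f h1)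

/-- Squeezing the sums of the differences attained on `B d` into the longer gaps at `W d`. -/
theorem sum_card_mul_clippedCard_le (n : ℕ) (A : Finset ℝ) (f : ℝ → ℝ)
    (hf : StrictMonoOn f A) (D : Finset ℝ) (hD : ∀ d ∈ D, 0 < d) (B W : ℝ → Finset ℝ)
    (hB : ∀ d ∈ D, B d ⊆ gapClass A d) (hW : ∀ d ∈ D, W d ⊆ gapClass A d)
    (h : ∀ d ∈ D, ∀ b ∈ B d, ∀ w ∈ W d, forwardDiff d f b ≤ forwardDiff d f w) :
    ∑ d ∈ D, (W d).card * clippedCard n ((B d).image (forwardDiff d f)) ≤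
      clippedCard (n + 1) (A.image f) := by
  have key := sum_card_le_card_clip (D.sigma W) (A.image f)
    (balancedSumset (n + 1) (A.image f)) (fun i => f i.2) (fun i => f (i.2 + i.1))
    (fun i => (clip ((B i.1).image (forwardDiff i.1 f))
      (balancedSumset n ((B i.1).image (forwardDiff i.1 f)))).image (f i.2 + ·)) ?_ ?_ ?_ ?_
  · rw [Finset.sum_sigma] at key
    refine le_trans (le_of_eq (Finset.sum_congr rfl fun d _ => ?_)) key
    simp only [Finset.card_image_of_injective _ (add_right_injective _), Finset.sum_const,
      smul_eq_mul, clippedCard]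
  · rintro ⟨d, w⟩ hi
    obtain ⟨hd, hw⟩ := Finset.mem_sigma.1 hi
    exact Finset.mem_image_of_mem f (mem_gapClass.1 (hW d hd hw)).1
  · rintro ⟨d, w⟩ hi
    obtain ⟨hd, hw⟩ := Finset.mem_sigma.1 hi
    exact Finset.mem_image_of_mem f (mem_gapClass.1 (hW d hd hw)).2.1
  · rintro ⟨d, w⟩ hi v hv
    obtain ⟨hd, hw⟩ := Finset.mem_sigma.1 hi
    obtain ⟨y, hy, rfl⟩ := Finset.mem_image.1 hv
    obtain ⟨hyQ, ⟨x, hx, hxy⟩, z, hz, hyz⟩ := mem_clip.1 hy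
    obtain ⟨b, hb, rfl⟩ := Finset.mem_image.1 hx
    obtain ⟨b', hb', rfl⟩ := Finset.mem_image.1 hz
    refine ⟨add_mem_balancedSumset_succ (image_forwardDiff_subset f (hB d hd))
      (Finset.mem_image_of_mem f (mem_gapClass.1 (hW d hd hw)).1) hyQ, ?_, ?_⟩
    · obtain ⟨h1, h2, -⟩ := mem_gapClass.1 (hB d hd hb)
      have h3 := hf h1 h2 (lt_add_of_pos_right b (hD d hd))
      simp only [forwardDiff] at hxy
      show f w < f w + y
      linarith
    · have h3 := h d hd b' hb' w hw
      simp only [forwardDiff] at hyz h3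
      show f w + y ≤ f (w + d)
      linarith
  · rintro ⟨d, w⟩ hi ⟨d', w'⟩ hj hne
    obtain ⟨hd, hw⟩ := Finset.mem_sigma.1 hi
    obtain ⟨hd', hw'⟩ := Finset.mem_sigma.1 hj
    have h1 := mem_gapClass.1 (hW d hd hw)
    have h2 := mem_gapClass.1 (hW d' hd' hw')
    rcases gap_intervals_disjoint (hD d hd) (hD d' hd') (hW d hd hw) (hW d' hd' hw')
      (by rintro rfl rfl; exact hne rfl) with h3 | h3
    · exact Or.inl (hf.monotoneOn h1.2.1 h2.1 h3)
    · exact Or.inr (hf.monotoneOn h2.2.1 h1.1 h3)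

/-- `f` is strictly increasing or strictly decreasing on `J`. -/
def StrictlyMonotonicOn (f : ℝ → ℝ) (J : Set ℝ) : Prop := StrictMonoOn f J ∨ StrictAntiOn f J

theorem StrictlyMonotonicOn.mono {f : ℝ → ℝ} {J J' : Set ℝ} (h : StrictlyMonotonicOn f J)
    (hJ : J' ⊆ J) : StrictlyMonotonicOn f J' :=
  h.imp (fun h => h.mono hJ) fun h => h.mono hJ

theorem StrictlyMonotonicOn.injOn {f : ℝ → ℝ} {J : Set ℝ} (h : StrictlyMonotonicOn f J) :
    Set.InjOn f J := h.elim (fun h => h.injOn) fun h => h.injOn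

theorem StrictlyMonotonicOn.neg {f : ℝ → ℝ} {J : Set ℝ} (h : StrictlyMonotonicOn f J) :
    StrictlyMonotonicOn (fun x => -f x) J :=
  h.symm.imp (fun h _ hx _ hy hxy => neg_lt_neg (h hx hy hxy))
    fun h _ hx _ hy hxy => neg_lt_neg (h hx hy hxy)

/-- The differences on the upper or on the lower third dominate those on the middle third, according
to the direction of monotonicity. The middle third does not depend on that direction, so the same `M
d` serves `f` and `g`, as the induction requires. -/
theorem sum_card_gapClass_mul_le_of_strictMonoOn (n : ℕ) (A : Finset ℝ) (f : ℝ → ℝ)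
    (hf : StrictMonoOn f A) (D : Finset ℝ) (hD : ∀ d ∈ D, 0 < d)
    (hdiff : ∀ d ∈ D, StrictlyMonotonicOn (forwardDiff d f) (gapClass A d))
    (L M U : ℝ → Finset ℝ) (hL : ∀ d, L d ⊆ gapClass A d) (hM : ∀ d, M d ⊆ gapClass A d)
    (hU : ∀ d, U d ⊆ gapClass A d) (hLM : ∀ d, ∀ l ∈ L d, ∀ m ∈ M d, l ≤ m)
    (hMU : ∀ d, ∀ m ∈ M d, ∀ u ∈ U d, m ≤ u)
    (hLc : ∀ d, (gapClass A d).card ≤ 3 * (L d).card)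
    (hUc : ∀ d, (gapClass A d).card ≤ 3 * (U d).card) :
    ∑ d ∈ D, (gapClass A d).card * clippedCard n ((M d).image (forwardDiff d f)) ≤
      3 * clippedCard (n + 1) (A.image f) := by
  have hex : ∀ d ∈ D, ∃ W, W ⊆ gapClass A d ∧ (gapClass A d).card ≤ 3 * W.card ∧
      ∀ b ∈ M d, ∀ w ∈ W, forwardDiff d f b ≤ forwardDiff d f w := by
    intro d hd
    rcases hdiff d hd with h | h
    · exact ⟨U d, hU d, hUc d, fun b hb w hw =>
        h.monotoneOn (hM d hb) (hU d hw) (hMU d b hb w hw)⟩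
    · exact ⟨L d, hL d, hLc d, fun b hb w hw =>
        h.antitoneOn (hL d hw) (hM d hb) (hLM d w hw b hb)⟩
  choose! W hW hWc hWM using hex
  refine le_trans ?_ (Nat.mul_le_mul_left 3
    (sum_card_mul_clippedCard_le n A f hf D hD M W (fun d _ => hM d) hW hWM))
  rw [Finset.mul_sum]
  refine Finset.sum_le_sum fun d hd => ?_
  rw [← mul_assoc]
  exact Nat.mul_le_mul_right _ (hWc d hd)

theorem sum_card_gapClass_mul_le (n : ℕ) (A : Finset ℝ) (f : ℝ → ℝ)
    (hf : StrictlyMonotonicOn f A) (D : Finset ℝ) (hD : ∀ d ∈ D, 0 < d)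
    (hdiff : ∀ d ∈ D, StrictlyMonotonicOn (forwardDiff d f) (gapClass A d))
    (L M U : ℝ → Finset ℝ) (hL : ∀ d, L d ⊆ gapClass A d) (hM : ∀ d, M d ⊆ gapClass A d)
    (hU : ∀ d, U d ⊆ gapClass A d) (hLM : ∀ d, ∀ l ∈ L d, ∀ m ∈ M d, l ≤ m)
    (hMU : ∀ d, ∀ m ∈ M d, ∀ u ∈ U d, m ≤ u)
    (hLc : ∀ d, (gapClass A d).card ≤ 3 * (L d).card)
    (hUc : ∀ d, (gapClass A d).card ≤ 3 * (U d).card) :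
    ∑ d ∈ D, (gapClass A d).card * clippedCard n ((M d).image (forwardDiff d f)) ≤
      3 * clippedCard (n + 1) (A.image f) := by
  rcases hf with hf | hf
  · exact sum_card_gapClass_mul_le_of_strictMonoOn n A f hf D hD hdiff L M U hL hM hU hLM hMU
      hLc hUc
  · have := sum_card_gapClass_mul_le_of_strictMonoOn n A (fun x => -f x)
      (fun x hx y hy hxy => neg_lt_neg (hf hx hy hxy)) D hD
      (fun d hd => by rw [forwardDiff_neg]; exact (hdiff d hd).neg) L M U hL hM hU hLM hMU hLc hUc
    simpa only [forwardDiff_neg, image_neg_fun, clippedCard_neg] using this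

/-- For an increasing `h` with distinct differences along each gap class, each gap class
contributes half of its square to `2h(X) - h(X)`. -/
theorem sum_card_gapClass_sq_le_of_strictMonoOn (X : Finset ℝ) (h : ℝ → ℝ)
    (hh : StrictMonoOn h X) (D : Finset ℝ) (hD : ∀ d ∈ D, 0 < d)
    (hinj : ∀ d ∈ D, Set.InjOn (forwardDiff d h) (gapClass X d)) :
    ∑ d ∈ D, (gapClass X d).card ^ 2 ≤ 2 * clippedCard 1 (X.image h) := by
  classical
  set P : ℝ → ℝ → Finset ℝ := fun d a =>
    (gapClass X d).filter fun b => forwardDiff d h b ≤ forwardDiff d h a with hP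
  have key := sum_card_le_card_clip (D.sigma (gapClass X)) (X.image h)
    (balancedSumset 1 (X.image h)) (fun i => h i.2) (fun i => h (i.2 + i.1))
    (fun i => (P i.1 i.2).image fun b => h i.2 + forwardDiff i.1 h b) ?_ ?_ ?_ ?_
  · have h1 : ∀ d ∈ D, (gapClass X d).card ^ 2 ≤ 2 * ∑ a ∈ gapClass X d, (P d a).card := by
      intro d _
      -- Each pair `(a, b)` is comparable in one of the two orders, so the two equal counts together
      -- cover the whole square.
      have hcomm : ∑ a ∈ gapClass X d, (P d a).card = ∑ a ∈ gapClass X d,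
          ((gapClass X d).filter fun b => forwardDiff d h a ≤ forwardDiff d h b).card := by
        simp only [hP, Finset.card_filter]
        exact Finset.sum_comm
      rw [two_mul]
      nth_rewrite 1 [hcomm]
      rw [← Finset.sum_add_distrib, sq, ← smul_eq_mul]
      refine Finset.card_nsmul_le_sum _ _ _ fun a _ => ?_
      refine le_trans (Finset.card_le_card fun b hb => ?_) (Finset.card_union_le _ _)
      rcases le_total (forwardDiff d h a) (forwardDiff d h b) with h2 | h2
      · exact Finset.mem_union_left _ (Finset.mem_filter.2 ⟨hb, h2⟩)
      · exact Finset.mem_union_right _ (Finset.mem_filter.2 ⟨hb, h2⟩)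
    refine (Finset.sum_le_sum h1).trans ?_
    rw [← Finset.mul_sum]
    refine Nat.mul_le_mul_left 2 (le_trans (le_of_eq ?_) key)
    rw [Finset.sum_sigma]
    refine Finset.sum_congr rfl fun d hd => Finset.sum_congr rfl fun a _ => ?_
    refine (Finset.card_image_of_injOn fun b hb c hc hbc => ?_).symm
    exact hinj d hd (Finset.mem_filter.1 hb).1 (Finset.mem_filter.1 hc).1 (add_left_cancel hbc)
  · rintro ⟨d, a⟩ hi
    exact Finset.mem_image_of_mem h (mem_gapClass.1 (Finset.mem_sigma.1 hi).2).1
  · rintro ⟨d, a⟩ hi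
    exact Finset.mem_image_of_mem h (mem_gapClass.1 (Finset.mem_sigma.1 hi).2).2.1
  · rintro ⟨d, a⟩ hi v hv
    obtain ⟨hd, ha⟩ := Finset.mem_sigma.1 hi
    obtain ⟨b, hb, rfl⟩ := Finset.mem_image.1 hv
    obtain ⟨hb, hba⟩ := Finset.mem_filter.1 hb
    obtain ⟨h1, h2, -⟩ := mem_gapClass.1 hb
    have h3 := hh h1 h2 (lt_add_of_pos_right b (hD d hd))
    simp only [forwardDiff] at hba ⊢
    refine ⟨?_, by linarith, by linarith⟩
    rw [balancedSumset_one, ← add_sub_assoc]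
    exact Finset.sub_mem_sub (Finset.add_mem_add
      (Finset.mem_image_of_mem h (mem_gapClass.1 ha).1) (Finset.mem_image_of_mem h h2))
      (Finset.mem_image_of_mem h h1)
  · rintro ⟨d, w⟩ hi ⟨d', w'⟩ hj hne
    obtain ⟨hd, hw⟩ := Finset.mem_sigma.1 hi
    obtain ⟨hd', hw'⟩ := Finset.mem_sigma.1 hj
    have h1 := mem_gapClass.1 hw
    have h2 := mem_gapClass.1 hw'
    rcases gap_intervals_disjoint (hD d hd) (hD d' hd') hw hw'
      (by rintro rfl rfl; exact hne rfl) with h3 | h3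
    · exact Or.inl (hh.monotoneOn h1.2.1 h2.1 h3)
    · exact Or.inr (hh.monotoneOn h2.2.1 h1.1 h3)

theorem sum_card_gapClass_sq_le (X : Finset ℝ) (h : ℝ → ℝ)
    (hh : StrictlyMonotonicOn h X) (D : Finset ℝ) (hD : ∀ d ∈ D, 0 < d)
    (hinj : ∀ d ∈ D, Set.InjOn (forwardDiff d h) (gapClass X d)) :
    ∑ d ∈ D, (gapClass X d).card ^ 2 ≤ 2 * clippedCard 1 (X.image h) := by
  rcases hh with hh | hh
  · exact sum_card_gapClass_sq_le_of_strictMonoOn X h hh D hD hinj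
  · have := sum_card_gapClass_sq_le_of_strictMonoOn X (fun x => -h x)
      (fun x hx y hy hxy => neg_lt_neg (hh hx hy hxy)) D hD (fun d hd x hx y hy hxy =>
        hinj d hd hx hy (by simpa only [forwardDiff_neg, neg_inj] using hxy))
    simpa only [image_neg_fun, clippedCard_neg] using this

/-! ### The inequality for difference regular pairs -/

/-- Equal nonzero differences of `f` come with distinct differences of `g`. -/
def SeparatesDifferences (f g : ℝ → ℝ) (J : Set ℝ) : Prop :=
  ∀ b ∈ J, ∀ b' ∈ J, ∀ c ∈ J, ∀ c' ∈ J, f b' - f b = f c' - f c → f b' ≠ f b → b ≠ c →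
    g b' - g b ≠ g c' - g c

/-- Both functions and their iterated differences up to order `n` are strictly monotonic, and the
differences of order `n` satisfy `SeparatesDifferences`. -/
def DifferenceRegular : ℕ → (ℝ → ℝ) → (ℝ → ℝ) → Set ℝ → Prop
  | 0, f, g, J =>
      StrictlyMonotonicOn f J ∧ StrictlyMonotonicOn g J ∧ SeparatesDifferences f g J
  | n + 1, f, g, J => StrictlyMonotonicOn f J ∧ StrictlyMonotonicOn g J ∧
      ∀ d, 0 < d → DifferenceRegular n (forwardDiff d f) (forwardDiff d g) {x | x ∈ J ∧ x + d ∈ J}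

theorem DifferenceRegular.left {n : ℕ} {f g : ℝ → ℝ} {J : Set ℝ}
    (h : DifferenceRegular n f g J) : StrictlyMonotonicOn f J := by
  cases n <;> exact h.1

theorem DifferenceRegular.right {n : ℕ} {f g : ℝ → ℝ} {J : Set ℝ}
    (h : DifferenceRegular n f g J) : StrictlyMonotonicOn g J := by
  cases n <;> exact h.2.1

/-- Popular classes have size at least `N² / (32F)`, so their squared sizes sum to at least `N³ /
(256F)`; squeezing bounds that sum by `2G`. -/
theorem card_pow_three_le (X : Finset ℝ) (hX : X.Nonempty) (h : ℝ → ℝ)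
    (hh : StrictlyMonotonicOn h X)
    (hinj : ∀ d, 0 < d → Set.InjOn (forwardDiff d h) (gapClass X d)) :
    (X.card : ℝ) ^ 3 ≤ 512 * (clippedCard 1 X * clippedCard 1 (X.image h)) := by
  have hN : 1 ≤ X.card := hX.card_pos
  have h1 : X.card ≤ clippedCard 1 X := card_le_clippedCard 1 X
  have h2 : 1 ≤ clippedCard 1 (X.image h) :=
    (Finset.one_le_card.2 (hX.image h)).trans (card_le_clippedCard 1 _)
  rcases hN.eq_or_lt with h3 | h3
  · rw [← h3]
    have h1' : (1 : ℝ) ≤ clippedCard 1 X := by exact_mod_cast hN.trans h1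
    have h2' : (1 : ℝ) ≤ clippedCard 1 (X.image h) := by exact_mod_cast h2
    norm_num
    nlinarith
  · obtain ⟨D, hD, hDs, hDp⟩ := exists_popular_gaps X h3
    have hsq := sum_card_gapClass_sq_le X h hh D hD fun d hd => hinj d (hD d hd)
    rw [← balancedSumset_one, ← clippedCard] at hDp
    set N : ℝ := (X.card : ℝ) with hNdef
    set F : ℝ := (clippedCard 1 X : ℝ) with hF
    set G : ℝ := (clippedCard 1 (X.image h) : ℝ) with hG
    have hsq' : ∑ d ∈ D, ((gapClass X d).card : ℝ) ^ 2 ≤ 2 * G := by rw [hG]; exact_mod_cast hsq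
    have hF0 : 0 ≤ F := by rw [hF]; positivity
    have hN0 : 0 < N := by rw [hNdef]; exact_mod_cast hX.card_pos
    have step : N ^ 2 * ∑ d ∈ D, ((gapClass X d).card : ℝ) ≤
        32 * F * ∑ d ∈ D, ((gapClass X d).card : ℝ) ^ 2 := by
      rw [Finset.mul_sum, Finset.mul_sum]
      refine Finset.sum_le_sum fun d hd => ?_
      have := mul_le_mul_of_nonneg_right (hDp d hd) (Nat.cast_nonneg (gapClass X d).card)
      linarith
    have e1 : N ^ 2 * N ≤ N ^ 2 * (8 * ∑ d ∈ D, ((gapClass X d).card : ℝ)) :=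
      mul_le_mul_of_nonneg_left hDs (by positivity)
    have e2 : 32 * F * ∑ d ∈ D, ((gapClass X d).card : ℝ) ^ 2 ≤ 32 * F * (2 * G) :=
      mul_le_mul_of_nonneg_left hsq' (by positivity)
    linarith

/-- Gaps are taken in `f(A)` rather than in `A`, with `g` viewed as a function of `f`; hence `A + A
- A` does not enter. -/
theorem card_pow_three_le_of_differenceRegular {f g : ℝ → ℝ} {J : Set ℝ} {A : Finset ℝ}
    (h : DifferenceRegular 0 f g J) (hA : ↑A ⊆ J) (hne : A.Nonempty) :
    (A.card : ℝ) ^ 3 ≤ 512 * (clippedCard 1 (A.image f) * clippedCard 1 (A.image g)) := by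
  obtain ⟨hf, hg, hsep⟩ := h
  have hfinj : Set.InjOn f A := hf.injOn.mono hA
  set e : ℝ → ℝ := Function.invFunOn f (A : Set ℝ) with he
  have hee : ∀ x ∈ A, e (f x) = x := fun x hx => hfinj.leftInvOn_invFunOn hx
  have himg : (A.image f).image (g ∘ e) = A.image g := by
    rw [Finset.image_image]
    refine Finset.image_congr fun x hx => ?_
    simp only [Function.comp_apply, hee x hx]
  have hcard : (A.image f).card = A.card := Finset.card_image_of_injOn hfinj
  rw [← hcard, ← himg]
  refine card_pow_three_le _ (hne.image f) _ ?_ ?_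
  · have hf' := hf.mono hA
    have hg' := hg.mono hA
    rw [Finset.coe_image]
    rcases hf' with hf' | hf' <;> rcases hg' with hg' | hg'
    · left
      rintro _ ⟨x, hx, rfl⟩ _ ⟨y, hy, rfl⟩ hxy
      simp only [Function.comp_apply, hee x hx, hee y hy]
      exact hg' hx hy ((hf'.lt_iff_lt hx hy).1 hxy)
    · right
      rintro _ ⟨x, hx, rfl⟩ _ ⟨y, hy, rfl⟩ hxy
      simp only [Function.comp_apply, hee x hx, hee y hy]
      exact hg' hx hy ((hf'.lt_iff_lt hx hy).1 hxy)
    · right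
      rintro _ ⟨x, hx, rfl⟩ _ ⟨y, hy, rfl⟩ hxy
      simp only [Function.comp_apply, hee x hx, hee y hy]
      exact hg' hy hx ((hf'.lt_iff_gt hx hy).1 hxy)
    · left
      rintro _ ⟨x, hx, rfl⟩ _ ⟨y, hy, rfl⟩ hxy
      simp only [Function.comp_apply, hee x hx, hee y hy]
      exact hg' hy hx ((hf'.lt_iff_gt hx hy).1 hxy)
  · intro d hd x hx y hy hxy
    obtain ⟨hx1, hx2, -⟩ := mem_gapClass.1 hx
    obtain ⟨hy1, hy2, -⟩ := mem_gapClass.1 hy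
    obtain ⟨b, hb, rfl⟩ := Finset.mem_image.1 hx1
    obtain ⟨b', hb', hbb⟩ := Finset.mem_image.1 hx2
    obtain ⟨c, hc, rfl⟩ := Finset.mem_image.1 hy1
    obtain ⟨c', hc', hcc⟩ := Finset.mem_image.1 hy2
    by_contra hne'
    refine hsep b (hA hb) b' (hA hb') c (hA hc) c' (hA hc') (by linarith) (by linarith)
      (fun h => hne' (by rw [h])) ?_
    simp only [forwardDiff, Function.comp_apply, ← hbb, ← hcc, hee _ hb, hee _ hb', hee _ hc,
      hee _ hc'] at hxy
    exact hxy

/-- Cauchy-Schwarz gives `(∑ m)² P ≤ (∑ m u)(∑ m v) ≤ 9FG`, where `P` is the lower bound for `u v`;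
the constant is `576 = 8² * 9`. -/
theorem pow_le_of_sum_le {D : Finset ℝ} {m u v : ℝ → ℝ} {N T F G c : ℝ} {e e' : ℕ}
    (hm : ∀ d, 0 ≤ m d) (hu : ∀ d, 0 ≤ u d) (hv : ∀ d, 0 ≤ v d) (hN : 0 < N) (hT : 0 < T)
    (hc : 0 < c) (hF : 0 ≤ F) (hNm : N ≤ 8 * ∑ d ∈ D, m d)
    (huv : ∀ d ∈ D, c * (N ^ 2 / (96 * T)) ^ e / T ^ e' ≤ u d * v d)
    (hsF : ∑ d ∈ D, m d * u d ≤ 3 * F) (hsG : ∑ d ∈ D, m d * v d ≤ 3 * G) :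
    c / (576 * 96 ^ e) * N ^ (2 + 2 * e) ≤ F * G * T ^ (e + e') := by
  set P : ℝ := c * (N ^ 2 / (96 * T)) ^ e / T ^ e' with hP
  have hP0 : 0 < P := by positivity
  have hCS := Finset.sum_sq_le_sum_mul_sum_of_sq_le_mul D (r := fun d => m d * √P)
    (f := fun d => m d * u d) (g := fun d => m d * v d)
    (fun d _ => mul_nonneg (hm d) (hu d)) (fun d _ => mul_nonneg (hm d) (hv d))
    (fun d hd => by
      rw [mul_pow, Real.sq_sqrt hP0.le]
      have := mul_le_mul_of_nonneg_left (huv d hd) (sq_nonneg (m d))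
      linarith)
  rw [← Finset.sum_mul, mul_pow, Real.sq_sqrt hP0.le] at hCS
  have hprod : (∑ d ∈ D, m d * u d) * ∑ d ∈ D, m d * v d ≤ 3 * F * (3 * G) :=
    mul_le_mul hsF hsG (Finset.sum_nonneg fun d _ => mul_nonneg (hm d) (hv d)) (by positivity)
  have hsq : N ^ 2 ≤ 64 * (∑ d ∈ D, m d) ^ 2 := by
    have := pow_le_pow_left₀ hN.le hNm 2
    linarith
  have hfin : N ^ 2 * P ≤ 576 * (F * G) := by
    have := mul_le_mul_of_nonneg_right hsq hP0.le
    linarith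
  have hPT : P * (96 ^ e * T ^ (e + e')) = c * N ^ (2 * e) := by
    rw [hP, div_pow, mul_pow, pow_add, pow_mul]
    field_simp
  clear_value P
  calc c / (576 * 96 ^ e) * N ^ (2 + 2 * e)
      = N ^ 2 * (c * N ^ (2 * e)) / (576 * 96 ^ e) := by rw [pow_add]; ring
    _ = N ^ 2 * P * (T ^ (e + e') / 576) := by rw [← hPT]; field_simp
    _ ≤ 576 * (F * G) * (T ^ (e + e') / 576) := by gcongr
    _ = F * G * T ^ (e + e') := by ring

theorem DifferenceRegular.exists_card_pow_le (n : ℕ) : ∃ c : ℝ, 0 < c ∧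
    ∀ (f g : ℝ → ℝ) (J : Set ℝ) (A : Finset ℝ), DifferenceRegular n f g J → ↑A ⊆ J → A.Nonempty →
      c * (A.card : ℝ) ^ (5 * 2 ^ n - 2) ≤
        clippedCard (n + 1) (A.image f) * clippedCard (n + 1) (A.image g) *
          ((A + A - A).card : ℝ) ^ (5 * 2 ^ n - 2 * (n + 1) - 3) := by
  induction n with
  | zero =>
    refine ⟨1 / 512, by norm_num, fun f g J A h hA hne => ?_⟩
    have := card_pow_three_le_of_differenceRegular h hA hne
    norm_num
    linarith
  | succ n ih =>
    obtain ⟨c, hc, ih⟩ := ih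
    set e := 5 * 2 ^ n - 2 with he
    set e' := 5 * 2 ^ n - 2 * (n + 1) - 3 with he'
    have hexp : 2 * (n + 1) + 3 ≤ 5 * 2 ^ n := by
      have := Nat.lt_two_pow_self (n := n)
      omega
    have h1 : 5 * 2 ^ (n + 1) - 2 = 2 + 2 * e := by rw [pow_succ]; omega
    have h2 : 5 * 2 ^ (n + 1) - 2 * (n + 1 + 1) - 3 = e + e' := by rw [pow_succ]; omega
    rw [h1, h2]
    -- The `1` serves singletons, which have no gaps.
    refine ⟨min 1 (c / (576 * 96 ^ e)), by positivity, fun f g J A h hA hne => ?_⟩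
    have hT1 : A.card ≤ (A + A - A).card := by
      rw [← balancedSumset_one]
      exact (card_le_clippedCard 1 A).trans (clippedCard_le 1 A)
    have hF1 : 1 ≤ clippedCard (n + 1 + 1) (A.image f) :=
      (Finset.one_le_card.2 (hne.image f)).trans (card_le_clippedCard _ _)
    have hG1 : 1 ≤ clippedCard (n + 1 + 1) (A.image g) :=
      (Finset.one_le_card.2 (hne.image g)).trans (card_le_clippedCard _ _)
    have hN1 : 1 ≤ A.card := hne.card_pos
    set N : ℝ := (A.card : ℝ) with hN
    set T : ℝ := ((A + A - A).card : ℝ) with hT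
    set F : ℝ := (clippedCard (n + 1 + 1) (A.image f) : ℝ) with hF
    set G : ℝ := (clippedCard (n + 1 + 1) (A.image g) : ℝ) with hG
    have hF1' : 1 ≤ F := by rw [hF]; exact_mod_cast hF1
    have hG1' : 1 ≤ G := by rw [hG]; exact_mod_cast hG1
    have hT1' : 1 ≤ T := by rw [hT]; exact_mod_cast hN1.trans hT1
    rcases hN1.eq_or_lt with h3 | h3
    · have hN' : N = 1 := by rw [hN, ← h3, Nat.cast_one]
      rw [hN', one_pow, mul_one]
      exact (min_le_left _ _).trans
        (one_le_mul_of_one_le_of_one_le (one_le_mul_of_one_le_of_one_le hF1' hG1')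
          (one_le_pow₀ hT1'))
    obtain ⟨D, hD, hDs, hDp⟩ := exists_popular_gaps A h3
    obtain ⟨hf, hg, hreg⟩ := h
    choose L M U hL hM hU hLM hMU hLc hMc hUc using fun d => exists_thirds (gapClass A d)
    have hsubJ : ∀ d, ↑(gapClass A d) ⊆ {x | x ∈ J ∧ x + d ∈ J} := fun d x hx =>
      ⟨hA (mem_gapClass.1 hx).1, hA (mem_gapClass.1 hx).2.1⟩
    have hsF := sum_card_gapClass_mul_le (n + 1) A f (hf.mono hA) D hD
      (fun d hd => (hreg d (hD d hd)).left.mono (hsubJ d)) L M U hL hM hU hLM hMU hLc hUc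
    have hsG := sum_card_gapClass_mul_le (n + 1) A g (hg.mono hA) D hD
      (fun d hd => (hreg d (hD d hd)).right.mono (hsubJ d)) L M U hL hM hU hLM hMU hLc hUc
    have hN0 : 0 < N := by rw [hN]; exact_mod_cast hN1
    have hT0 : 0 < T := by linarith
    have hclipT : ((clip A (A + A - A)).card : ℝ) ≤ T := by
      rw [hT]; exact_mod_cast Finset.card_le_card fun z hz => (mem_clip.1 hz).1
    refine le_trans (mul_le_mul_of_nonneg_right (min_le_right _ _) (by positivity))
      (pow_le_of_sum_le (D := D) (m := fun d => ((gapClass A d).card : ℝ))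
        (u := fun d => (clippedCard (n + 1) ((M d).image (forwardDiff d f)) : ℝ))
        (v := fun d => (clippedCard (n + 1) ((M d).image (forwardDiff d g)) : ℝ))
        (fun _ => Nat.cast_nonneg _) (fun _ => Nat.cast_nonneg _) (fun _ => Nat.cast_nonneg _)
        hN0 hT0 hc (by linarith) hDs (fun d hd => ?_)
        (by rw [hF]; exact_mod_cast hsF) (by rw [hG]; exact_mod_cast hsG))
    have hm1 : N ^ 2 ≤ 32 * T * ((gapClass A d).card : ℝ) := (hDp d hd).trans (by gcongr)
    have hm3 : ((gapClass A d).card : ℝ) ≤ 3 * ((M d).card : ℝ) := by exact_mod_cast hMc d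
    -- `96 = 32 * 3`: popularity of the gap, then passage to a third.
    have hMlow : N ^ 2 / (96 * T) ≤ ((M d).card : ℝ) := by
      rw [div_le_iff₀ (by positivity)]
      have := mul_le_mul_of_nonneg_left hm3 hT0.le
      linarith
    have hMne : (M d).Nonempty := by
      rw [← Finset.card_pos]
      have : (0 : ℝ) < (M d).card := lt_of_lt_of_le (by positivity) hMlow
      exact_mod_cast this
    have hMT : ((M d + M d - M d).card : ℝ) ≤ T := by
      have hMA : M d ⊆ A := (hM d).trans (gapClass_subset A d)
      rw [hT]
      exact_mod_cast Finset.card_le_card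
        (Finset.sub_subset_sub (Finset.add_subset_add hMA hMA) hMA)
    have hih := ih _ _ _ (M d) (hreg d (hD d hd))
      ((Finset.coe_subset.2 (hM d)).trans (hsubJ d)) hMne
    rw [div_le_iff₀ (by positivity)]
    refine le_trans (mul_le_mul_of_nonneg_left (pow_le_pow_left₀ (by positivity) hMlow e) hc.le)
      (hih.trans (mul_le_mul_of_nonneg_left (pow_le_pow_left₀ (Nat.cast_nonneg _) hMT e')
        (by positivity)))

/-! ### Chord slopes and difference regularity -/

/-- The slope of the chord of the curve `(ψ, φ)` between the parameters `x` and `y`. -/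
noncomputable def chordSlope (ψ φ : ℝ → ℝ) (x y : ℝ) : ℝ := (φ y - φ x) / (ψ y - ψ x)

theorem strictlyMonotonicOn_of_hasDerivAt {J : Set ℝ} (hJ : J.OrdConnected) {f f' : ℝ → ℝ}
    (hf : ∀ x ∈ J, HasDerivAt f (f' x) x) (hne : ∀ x ∈ J, f' x ≠ 0) :
    StrictlyMonotonicOn f J := by
  have hcont : ContinuousOn f J := fun x hx => (hf x hx).continuousAt.continuousWithinAt
  rcases hasDerivWithinAt_forall_lt_or_forall_gt_of_forall_ne hJ.convex
    (fun x hx => (hf x hx).hasDerivWithinAt) hne with h | h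
  · exact Or.inr (strictAntiOn_of_deriv_neg hJ.convex hcont fun x hx => by
      rw [(hf x (interior_subset hx)).deriv]; exact h x (interior_subset hx))
  · exact Or.inl (strictMonoOn_of_deriv_pos hJ.convex hcont fun x hx => by
      rw [(hf x (interior_subset hx)).deriv]; exact h x (interior_subset hx))

section Chords

variable {J : Set ℝ} {ψ ψ' φ φ' : ℝ → ℝ}

theorem exists_chordSlope_eq (hJ : J.OrdConnected) (hψ : ∀ x ∈ J, HasDerivAt ψ (ψ' x) x)
    (hφ : ∀ x ∈ J, HasDerivAt φ (φ' x) x) (hne : ∀ x ∈ J, ψ' x ≠ 0) {x y : ℝ} (hx : x ∈ J)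
    (hy : y ∈ J) (hxy : x < y) :
    ∃ ξ ∈ J, x < ξ ∧ ξ < y ∧ chordSlope ψ φ x y = φ' ξ / ψ' ξ := by
  have hsub : Set.Icc x y ⊆ J := hJ.out hx hy
  obtain ⟨ξ, hξ, h⟩ := exists_ratio_hasDerivAt_eq_ratio_slope φ φ' hxy
    (fun z hz => (hφ z (hsub hz)).continuousAt.continuousWithinAt)
    (fun z hz => hφ z (hsub (Set.Ioo_subset_Icc_self hz))) ψ ψ'
    (fun z hz => (hψ z (hsub hz)).continuousAt.continuousWithinAt)
    (fun z hz => hψ z (hsub (Set.Ioo_subset_Icc_self hz)))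
  have hξJ := hsub (Set.Ioo_subset_Icc_self hξ)
  have hψne : ψ y - ψ x ≠ 0 := sub_ne_zero.2 fun he =>
    hxy.ne' ((strictlyMonotonicOn_of_hasDerivAt hJ hψ hne).injOn hy hx he)
  refine ⟨ξ, hξJ, hξ.1, hξ.2, ?_⟩
  rw [chordSlope, div_eq_div_iff hψne (hne ξ hξJ)]
  linarith

/-- By Cauchy's mean value theorem the slopes over `[x, y]` and `[y, z]` are values of `φ' / ψ'` at
ordered points. The slope over `[x, z]` is a weighted mean of the two, with positive weights because
`ψ` is monotonic. -/
theorem chordSlope_lt_chordSlope_lt (hJ : J.OrdConnected) (hψ : ∀ x ∈ J, HasDerivAt ψ (ψ' x) x)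
    (hφ : ∀ x ∈ J, HasDerivAt φ (φ' x) x) (hne : ∀ x ∈ J, ψ' x ≠ 0)
    (hr : StrictMonoOn (fun x => φ' x / ψ' x) J) {x y z : ℝ} (hx : x ∈ J) (hy : y ∈ J)
    (hz : z ∈ J) (hxy : x < y) (hyz : y < z) :
    chordSlope ψ φ x y < chordSlope ψ φ x z ∧ chordSlope ψ φ x z < chordSlope ψ φ y z := by
  obtain ⟨ξ, hξ, -, hξy, h1⟩ := exists_chordSlope_eq hJ hψ hφ hne hx hy hxy
  obtain ⟨η, hη, hyη, -, h2⟩ := exists_chordSlope_eq hJ hψ hφ hne hy hz hyz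
  have hlt : chordSlope ψ φ x y < chordSlope ψ φ y z := by
    rw [h1, h2]; exact hr hξ hη (hξy.trans hyη)
  set s := chordSlope ψ φ x y with hs
  set t := chordSlope ψ φ y z with ht
  have hmono := strictlyMonotonicOn_of_hasDerivAt hJ hψ hne
  have hinj := hmono.injOn
  have d1 : ψ y - ψ x ≠ 0 := sub_ne_zero.2 fun he => hxy.ne' (hinj hy hx he)
  have d2 : ψ z - ψ y ≠ 0 := sub_ne_zero.2 fun he => hyz.ne' (hinj hz hy he)
  have e1 : φ y - φ x = s * (ψ y - ψ x) := by rw [hs, chordSlope, div_mul_cancel₀ _ d1]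
  have e2 : φ z - φ y = t * (ψ z - ψ y) := by rw [ht, chordSlope, div_mul_cancel₀ _ d2]
  have e3 : φ z - φ x = s * (ψ y - ψ x) + t * (ψ z - ψ y) := by linarith
  rw [chordSlope, e3]
  rcases hmono with hm | hm
  · have p1 := hm hx hy hxy
    have p2 := hm hy hz hyz
    rw [lt_div_iff₀ (by linarith), div_lt_iff₀ (by linarith)]
    constructor <;> nlinarith
  · have p1 := hm hx hy hxy
    have p2 := hm hy hz hyz
    rw [lt_div_iff_of_neg (by linarith), div_lt_iff_of_neg (by linarith)]
    constructor <;> nlinarith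

/-- Move one endpoint at a time, through the chord from `x` to `y'`. -/
theorem chordSlope_lt_of_strictMonoOn (hJ : J.OrdConnected)
    (hψ : ∀ x ∈ J, HasDerivAt ψ (ψ' x) x) (hφ : ∀ x ∈ J, HasDerivAt φ (φ' x) x)
    (hne : ∀ x ∈ J, ψ' x ≠ 0) (hr : StrictMonoOn (fun x => φ' x / ψ' x) J) {x x' y y' : ℝ}
    (hx : x ∈ J) (hx' : x' ∈ J) (hy : y ∈ J) (hy' : y' ∈ J) (hxx : x < x') (hyy : y < y')
    (hxy : x < y) (hxy' : x' < y') : chordSlope ψ φ x x' < chordSlope ψ φ y y' :=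
  (chordSlope_lt_chordSlope_lt hJ hψ hφ hne hr hx hx' hy' hxx hxy').1.trans
    (chordSlope_lt_chordSlope_lt hJ hψ hφ hne hr hx hy hy' hxy hyy).2

theorem chordSlope_lt_or_gt (hJ : J.OrdConnected)
    (hψ : ∀ x ∈ J, HasDerivAt ψ (ψ' x) x) (hφ : ∀ x ∈ J, HasDerivAt φ (φ' x) x)
    (hne : ∀ x ∈ J, ψ' x ≠ 0) (hr : StrictlyMonotonicOn (fun x => φ' x / ψ' x) J) :
    (∀ x ∈ J, ∀ x' ∈ J, ∀ y ∈ J, ∀ y' ∈ J, x < x' → y < y' → x < y → x' < y' →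
      chordSlope ψ φ x x' < chordSlope ψ φ y y') ∨
    (∀ x ∈ J, ∀ x' ∈ J, ∀ y ∈ J, ∀ y' ∈ J, x < x' → y < y' → x < y → x' < y' →
      chordSlope ψ φ y y' < chordSlope ψ φ x x') := by
  rcases hr with hr | hr
  · exact Or.inl fun x hx x' hx' y hy y' hy' h1 h2 h3 h4 =>
      chordSlope_lt_of_strictMonoOn hJ hψ hφ hne hr hx hx' hy hy' h1 h2 h3 h4
  · refine Or.inr fun x hx x' hx' y hy y' hy' h1 h2 h3 h4 => ?_
    have h := chordSlope_lt_of_strictMonoOn (φ := fun x => -φ x) (φ' := fun x => -φ' x) hJ hψ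
      (fun x hx => (hφ x hx).neg) hne (fun x hx y hy hxy => by
        simpa only [neg_div] using neg_lt_neg (hr hx hy hxy)) hx hx' hy hy' h1 h2 h3 h4
    have hneg : ∀ x y, chordSlope ψ (fun x => -φ x) x y = -chordSlope ψ φ x y := fun x y => by
      simp only [chordSlope]; ring
    rw [hneg, hneg] at h
    linarith

/-- Equal differences of both functions would give two chords of equal slope, one shifted along the
curve from the other; slopes are strictly monotonic under such a shift. -/
theorem separatesDifferences_of_hasDerivAt (hJ : J.OrdConnected)
    (hψ : ∀ x ∈ J, HasDerivAt ψ (ψ' x) x) (hφ : ∀ x ∈ J, HasDerivAt φ (φ' x) x)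
    (hne : ∀ x ∈ J, ψ' x ≠ 0) (hr : StrictlyMonotonicOn (fun x => φ' x / ψ' x) J) :
    SeparatesDifferences ψ φ J := by
  have hmono := strictlyMonotonicOn_of_hasDerivAt hJ hψ hne
  have core : ∀ b ∈ J, ∀ b' ∈ J, ∀ c ∈ J, ∀ c' ∈ J, ψ b' - ψ b = ψ c' - ψ c → b < b' → b < c →
      φ b' - φ b ≠ φ c' - φ c := by
    intro b hb b' hb' c hc c' hc' he hbb hbc hg
    have horder : c < c' ∧ b' < c' := by
      rcases hmono with hm | hm
      · have p1 := hm hb hb' hbb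
        have p2 := hm hb hc hbc
        exact ⟨(hm.lt_iff_lt hc hc').1 (by linarith), (hm.lt_iff_lt hb' hc').1 (by linarith)⟩
      · have p1 := hm hb hb' hbb
        have p2 := hm hb hc hbc
        exact ⟨(hm.lt_iff_gt hc' hc).1 (by linarith), (hm.lt_iff_gt hc' hb').1 (by linarith)⟩
    have hchord : chordSlope ψ φ b b' = chordSlope ψ φ c c' := by
      rw [chordSlope, chordSlope, he, hg]
    rcases chordSlope_lt_or_gt hJ hψ hφ hne hr with h | h
    · exact (h b hb b' hb' c hc c' hc' hbb horder.1 hbc horder.2).ne hchord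
    · exact (h b hb b' hb' c hc c' hc' hbb horder.1 hbc horder.2).ne' hchord
  have core' : ∀ b ∈ J, ∀ b' ∈ J, ∀ c ∈ J, ∀ c' ∈ J, ψ b' - ψ b = ψ c' - ψ c → b < b' → b ≠ c →
      φ b' - φ b ≠ φ c' - φ c := by
    intro b hb b' hb' c hc c' hc' he hbb hbc
    rcases lt_or_gt_of_ne hbc with h | h
    · exact core b hb b' hb' c hc c' hc' he hbb h
    · refine (core c hc c' hc' b hb b' hb' he.symm ?_ h).symm
      rcases hmono with hm | hm
      · have p1 := hm hb hb' hbb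
        exact (hm.lt_iff_lt hc hc').1 (by linarith)
      · have p1 := hm hb hb' hbb
        exact (hm.lt_iff_gt hc' hc).1 (by linarith)
  intro b hb b' hb' c hc c' hc' he hbb hbc hg
  rcases lt_trichotomy b b' with h | h | h
  · exact core' b hb b' hb' c hc c' hc' he h hbc hg
  · exact hbb (by rw [h])
  · refine core' b' hb' b hb c' hc' c hc (by linarith) h (fun h' => hbc ?_) (by linarith)
    subst h'
    exact hmono.injOn hb hc (by linarith)

end Chords

/-- Nonvanishing derivatives up to order `n + 1` and a strictly monotonic quotient of the
derivatives of order `n + 1` make a pair of functions difference regular of order `n`. -/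
theorem differenceRegular_of_hasDerivAt (n : ℕ) : ∀ (F G : ℕ → ℝ → ℝ) (J : Set ℝ),
    J.OrdConnected → (∀ j, ∀ x ∈ J, HasDerivAt (F j) (F (j + 1) x) x) →
    (∀ j, ∀ x ∈ J, HasDerivAt (G j) (G (j + 1) x) x) →
    (∀ j ≤ n, ∀ x ∈ J, F (j + 1) x ≠ 0) → (∀ j ≤ n, ∀ x ∈ J, G (j + 1) x ≠ 0) →
    StrictlyMonotonicOn (fun x => G (n + 1) x / F (n + 1) x) J →
    DifferenceRegular n (F 0) (G 0) J := by
  induction n with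
  | zero =>
    intro F G J hJ hF hG hF0 hG0 hr
    exact ⟨strictlyMonotonicOn_of_hasDerivAt hJ (hF 0) (hF0 0 le_rfl),
      strictlyMonotonicOn_of_hasDerivAt hJ (hG 0) (hG0 0 le_rfl),
      separatesDifferences_of_hasDerivAt hJ (hF 0) (hG 0) (hF0 0 le_rfl) hr⟩
  | succ n ih =>
    intro F G J hJ hF hG hF0 hG0 hr
    refine ⟨strictlyMonotonicOn_of_hasDerivAt hJ (hF 0) (hF0 0 (Nat.zero_le _)),
      strictlyMonotonicOn_of_hasDerivAt hJ (hG 0) (hG0 0 (Nat.zero_le _)), fun d hd => ?_⟩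
    have hdiff : ∀ H : ℕ → ℝ → ℝ, (∀ j, ∀ x ∈ J, HasDerivAt (H j) (H (j + 1) x) x) →
        ∀ j, ∀ x ∈ {x | x ∈ J ∧ x + d ∈ J},
          HasDerivAt (forwardDiff d (H j)) (forwardDiff d (H (j + 1)) x) x :=
      fun H hH j x hx => ((hH j _ hx.2).comp_add_const x d).sub (hH j x hx.1)
    have hne : ∀ H : ℕ → ℝ → ℝ, (∀ j, ∀ x ∈ J, HasDerivAt (H j) (H (j + 1) x) x) →
        (∀ j ≤ n + 1, ∀ x ∈ J, H (j + 1) x ≠ 0) → ∀ j ≤ n, ∀ x ∈ {x | x ∈ J ∧ x + d ∈ J},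
          forwardDiff d (H (j + 1)) x ≠ 0 := by
      intro H hH hH0 j hj x hx he
      have := (strictlyMonotonicOn_of_hasDerivAt hJ (hH (j + 1))
        (hH0 (j + 1) (by omega))).injOn hx.2 hx.1 (sub_eq_zero.1 he)
      linarith
    refine ih (fun j => forwardDiff d (F j)) (fun j => forwardDiff d (G j)) _ ?_ (hdiff F hF)
      (hdiff G hG) (hne F hF hF0) (hne G hG hG0) ?_
    · exact ⟨fun x hx y hy z hz => ⟨hJ.out hx.1 hy.1 hz,
        hJ.out hx.2 hy.2 ⟨by linarith [hz.1], by linarith [hz.2]⟩⟩⟩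
    -- The new quotient at `x` is the chord slope of `(F (n + 1), G (n + 1))` from `x` to `x + d`.
    · rcases chordSlope_lt_or_gt hJ (hF (n + 1)) (hG (n + 1)) (hF0 (n + 1) le_rfl) hr with h | h
      · exact Or.inl fun x hx y hy hxy => h x hx.1 _ hx.2 y hy.1 _ hy.2 (by linarith)
          (by linarith) hxy (by linarith)
      · exact Or.inr fun x hx y hy hxy => h x hx.1 _ hx.2 y hy.1 _ hy.2 (by linarith)
          (by linarith) hxy (by linarith)

/-! ### Zeros and Wronskians of analytic functions -/

section Analytic

variable {a b : ℝ}

/-- Infinitely many zeros would accumulate in the compact interval, against the identity theorem. -/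
theorem finite_zeros_of_analyticOnNhd {h : ℝ → ℝ} (hh : AnalyticOnNhd ℝ h (Set.Icc a b))
    (hne : ¬ Set.EqOn h 0 (Set.Icc a b)) : {x ∈ Set.Icc a b | h x = 0}.Finite := by
  by_contra hinf
  obtain ⟨x, hx, hacc⟩ := Set.Infinite.exists_accPt_of_subset_isCompact hinf isCompact_Icc
    fun x hx => hx.1
  refine hne (hh.eqOn_zero_of_preconnected_of_frequently_eq_zero isPreconnected_Icc hx ?_)
  exact (accPt_iff_frequently_nhdsNE.1 hacc).mono fun y hy => hy.2

theorem eqOn_zero_of_eventually {h : ℝ → ℝ} (hh : AnalyticOnNhd ℝ h (Set.Icc a b)) {x : ℝ}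
    (hx : x ∈ Set.Icc a b) (he : ∀ᶠ y in nhds x, h y = 0) : Set.EqOn h 0 (Set.Icc a b) :=
  hh.eqOn_zero_of_preconnected_of_eventuallyEq_zero isPreconnected_Icc hx he

theorem analyticOnNhd_iteratedDeriv {f : ℝ → ℝ} {s : Set ℝ} (hf : AnalyticOnNhd ℝ f s) (j : ℕ) :
    AnalyticOnNhd ℝ (iteratedDeriv j f) s := by
  rw [iteratedDeriv_eq_iterate]; exact hf.iterated_deriv j

theorem hasDerivAt_iteratedDeriv {f : ℝ → ℝ} {s : Set ℝ} (hf : AnalyticOnNhd ℝ f s) (j : ℕ)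
    {x : ℝ} (hx : x ∈ s) : HasDerivAt (iteratedDeriv j f) (iteratedDeriv (j + 1) f x) x := by
  rw [iteratedDeriv_succ]
  exact (analyticOnNhd_iteratedDeriv hf j x hx).differentiableAt.hasDerivAt

theorem iteratedDeriv_eqOn_zero_add (hab : a < b) {f : ℝ → ℝ}
    (hf : AnalyticOnNhd ℝ f (Set.Icc a b)) {j : ℕ}
    (h : Set.EqOn (iteratedDeriv j f) 0 (Set.Icc a b)) (i : ℕ) :
    Set.EqOn (iteratedDeriv (j + i) f) 0 (Set.Icc a b) := by
  induction i with
  | zero => exact h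
  | succ i ih =>
    obtain ⟨x, hx⟩ := Set.nonempty_Ioo.2 hab
    refine eqOn_zero_of_eventually (analyticOnNhd_iteratedDeriv hf _)
      (Set.Ioo_subset_Icc_self hx) ?_
    filter_upwards [isOpen_Ioo.mem_nhds hx] with y hy
    rw [← add_assoc, iteratedDeriv_succ]
    have : iteratedDeriv (j + i) f =ᶠ[nhds y] fun _ => 0 := by
      filter_upwards [isOpen_Ioo.mem_nhds hy] with z hz
      exact ih (Set.Ioo_subset_Icc_self hz)
    rw [this.deriv_eq, deriv_const]

/-- Two analytic functions whose Wronskian vanishes identically are proportional. -/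
theorem exists_eqOn_mul_of_wronskian (hab : a < b) {u v : ℝ → ℝ}
    (hu : AnalyticOnNhd ℝ u (Set.Icc a b)) (hv : AnalyticOnNhd ℝ v (Set.Icc a b))
    (hu0 : ¬ Set.EqOn u 0 (Set.Icc a b))
    (hW : Set.EqOn (fun x => deriv v x * u x - v x * deriv u x) 0 (Set.Icc a b)) :
    ∃ l : ℝ, Set.EqOn v (fun x => l * u x) (Set.Icc a b) := by
  obtain ⟨x, hx, hxu⟩ : ∃ x ∈ Set.Ioo a b, u x ≠ 0 := by
    by_contra! hcon
    obtain ⟨x, hx⟩ := Set.nonempty_Ioo.2 hab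
    refine hu0 (eqOn_zero_of_eventually hu (Set.Ioo_subset_Icc_self hx) ?_)
    filter_upwards [isOpen_Ioo.mem_nhds hx] with y hy using hcon y hy
  have hxI := Set.Ioo_subset_Icc_self hx
  obtain ⟨ε, hε, hball⟩ := Metric.eventually_nhds_iff_ball.1
    (((hu x hxI).continuousAt.eventually_ne hxu).and (isOpen_Ioo.mem_nhds hx))
  have hdiv : ∀ y ∈ Metric.ball x ε, HasDerivAt (fun z => v z / u z)
      ((deriv v y * u y - v y * deriv u y) / u y ^ 2) y := fun y hy =>
    have hyI := Set.Ioo_subset_Icc_self (hball y hy).2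
    (hv y hyI).differentiableAt.hasDerivAt.div (hu y hyI).differentiableAt.hasDerivAt
      (hball y hy).1
  refine ⟨v x / u x, fun y hy => ?_⟩
  have hlin : AnalyticOnNhd ℝ (fun y => v y - v x / u x * u y) (Set.Icc a b) :=
    hv.sub (analyticOnNhd_const.mul hu)
  refine sub_eq_zero.1 (eqOn_zero_of_eventually hlin hxI ?_ hy)
  filter_upwards [Metric.ball_mem_nhds x hε] with z hz
  -- Near a point where `u ≠ 0`, the derivative of `v / u` is the Wronskian over `u²`, hence zero;
  -- the identity theorem then spreads proportionality to the whole interval.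
  have hconst : v z / u z = v x / u x := by
    refine Metric.isOpen_ball.is_const_of_deriv_eq_zero (convex_ball x ε).isPreconnected
      (f := fun z => v z / u z)
      (fun y hy => (hdiv y hy).differentiableAt.differentiableWithinAt) (fun y hy => ?_) hz
      (Metric.mem_ball_self hε)
    rw [(hdiv y hy).deriv]
    have := hW (Set.Ioo_subset_Icc_self (hball y hy).2)
    simp only [Pi.zero_apply] at this
    simp [this]
  rw [← hconst, div_mul_cancel₀ _ (hball z hz).1, sub_self]

end Analytic

/-! ### Reduction to intervals of regularity -/

/-- Removing finitely many points cuts an interval into intervals, one of which holds a positive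
proportion of a given finite set. -/
theorem exists_subinterval_avoiding {I : Set ℝ} (hI : I.OrdConnected) (Z A : Finset ℝ)
    (hA : ↑A ⊆ I) (hAZ : (A \ Z).Nonempty) :
    ∃ (J : Set ℝ) (A' : Finset ℝ), J.OrdConnected ∧ J ⊆ I ∧ (∀ x ∈ J, x ∉ Z) ∧ A' ⊆ A ∧ ↑A' ⊆ J ∧
      A'.Nonempty ∧ A.card ≤ (Z.card + 1) ^ 2 * A'.card := by
  classical
  -- Off `Z`, this index labels the component of the complement containing `x`.
  set idx : ℝ → ℕ := fun x => (Z.filter (· < x)).card with hidx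
  have hidxmono : ∀ x y, x ≤ y → idx x ≤ idx y := fun x y hxy =>
    Finset.card_le_card fun z hz => Finset.mem_filter.2
      ⟨(Finset.mem_filter.1 hz).1, (Finset.mem_filter.1 hz).2.trans_le hxy⟩
  have hmaps : ∀ x ∈ A \ Z, idx x ∈ Finset.range (Z.card + 1) := fun x _ =>
    Finset.mem_range.2 (Nat.lt_succ_of_le (Finset.card_filter_le _ _))
  obtain ⟨i, -, hi⟩ := Finset.exists_max_image (Finset.range (Z.card + 1))
    (fun i => ((A \ Z).filter fun x => idx x = i).card) ⟨0, by simp⟩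
  have hcard := Finset.card_le_mul_card_image_of_maps_to hmaps _ hi
  rw [Finset.card_range] at hcard
  set A' := (A \ Z).filter fun x => idx x = i with hA'
  have hpos : 0 < (A \ Z).card := hAZ.card_pos
  have hA'pos : 0 < A'.card := by
    rcases Nat.eq_zero_or_pos A'.card with h | h
    · rw [h] at hcard; omega
    · exact h
  refine ⟨{x | x ∈ I ∧ x ∉ Z ∧ idx x = i}, A', ⟨fun x hx y hy w hw => ?_⟩, fun x hx => hx.1,
    fun x hx => hx.2.1, fun x hx => ?_, fun x hx => ?_, Finset.card_pos.1 hA'pos, ?_⟩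
  · have h1 := hidxmono x w hw.1
    have h2 := hidxmono w y hw.2
    refine ⟨hI.out hx.1 hy.1 hw, fun hwZ => ?_, by have := hx.2.2; have := hy.2.2; omega⟩
    have hxw : x < w := lt_of_le_of_ne hw.1 fun h => hx.2.1 (h ▸ hwZ)
    have hwy : w < y := lt_of_le_of_ne hw.2 fun h => hy.2.1 (h ▸ hwZ)
    have : idx x < idx y := by
      refine Finset.card_lt_card (Finset.ssubset_iff_of_subset (fun z hz => ?_) |>.2
        ⟨w, Finset.mem_filter.2 ⟨hwZ, hwy⟩, fun h => ?_⟩)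
      · exact Finset.mem_filter.2 ⟨(Finset.mem_filter.1 hz).1,
          (Finset.mem_filter.1 hz).2.trans (hxw.trans hwy)⟩
      · exact absurd (Finset.mem_filter.1 h).2 (not_lt.2 hw.1)
    have := hx.2.2
    have := hy.2.2
    omega
  · exact (Finset.mem_sdiff.1 (Finset.mem_filter.1 hx).1).1
  · obtain ⟨h1, h2⟩ := Finset.mem_filter.1 hx
    exact ⟨hA (Finset.mem_sdiff.1 h1).1, (Finset.mem_sdiff.1 h1).2, h2⟩
  · have h3 : A.card ≤ Z.card + (A \ Z).card := by
      have := Finset.card_le_card_sdiff_add_card (s := A) (t := Z)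
      omega
    calc A.card ≤ Z.card * (A \ Z).card + (A \ Z).card := by
          refine h3.trans (Nat.add_le_add_right (Nat.le_mul_of_pos_right _ hpos) _)
      _ = (Z.card + 1) * (A \ Z).card := by ring
      _ ≤ (Z.card + 1) * (A'.card * (Z.card + 1)) := Nat.mul_le_mul_left _ hcard
      _ = (Z.card + 1) ^ 2 * A'.card := by ring

/-- Away from finitely many points, a `k`-independent pair is difference regular. -/
theorem KIndependent.exists_finset_differenceRegular {n : ℕ} {a b : ℝ} (hab : a ≤ b)
    {f g : ℝ → ℝ} (hfg : KIndependent (n + 1) (Set.Icc a b) ![f, g]) :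
    ∃ Z : Finset ℝ, ∀ J : Set ℝ, J.OrdConnected → J ⊆ Set.Icc a b → (∀ x ∈ J, x ∉ Z) →
      DifferenceRegular n f g J := by
  obtain ⟨han, hli⟩ := hfg
  have hf : AnalyticOnNhd ℝ f (Set.Icc a b) := han 0
  have hg : AnalyticOnNhd ℝ g (Set.Icc a b) := han 1
  set u := iteratedDeriv (n + 1) f with hu
  set v := iteratedDeriv (n + 1) g with hv
  have hpair : ∀ s t : ℝ, (∀ x ∈ Set.Icc a b, s * u x + t * v x = 0) → s = 0 ∧ t = 0 := by
    have hfam : (fun i (x : Set.Icc a b) => iteratedDeriv (n + 1) (![f, g] i) (x : ℝ)) =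
        ![fun x : Set.Icc a b => u x, fun x : Set.Icc a b => v x] := by
      funext i; fin_cases i <;> rfl
    rw [hfam, LinearIndependent.pair_iff] at hli
    intro s t h
    exact hli s t (funext fun x => h x x.2)
  -- On a single point the functions form a one-dimensional space, so two of them cannot be
  -- independent.
  have hab' : a < b := by
    refine lt_of_le_of_ne hab fun h => ?_
    subst h
    have h1 := hpair (v a) (-u a) fun x hx => by
      rw [Set.Icc_self, Set.mem_singleton_iff] at hx; subst hx; ring
    have h2 := hpair 1 0 fun x hx => by
      rw [Set.Icc_self, Set.mem_singleton_iff] at hx; subst hx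
      linarith [h1.2]
    exact one_ne_zero h2.1
  have hu0 : ¬ Set.EqOn u 0 (Set.Icc a b) := fun h =>
    one_ne_zero (hpair 1 0 fun x hx => by rw [h hx]; simp).1
  have hv0 : ¬ Set.EqOn v 0 (Set.Icc a b) := fun h =>
    one_ne_zero (hpair 0 1 fun x hx => by rw [h hx]; simp).2
  have hfin : ∀ h : ℝ → ℝ, AnalyticOnNhd ℝ h (Set.Icc a b) →
      ¬ Set.EqOn (iteratedDeriv (n + 1) h) 0 (Set.Icc a b) →
      ({x | x ∈ Set.Icc a b ∧ ∃ j ≤ n, iteratedDeriv (j + 1) h x = 0}).Finite := by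
    intro h hh hne
    have hj : ∀ j ∈ Set.Iic n, {x ∈ Set.Icc a b | iteratedDeriv (j + 1) h x = 0}.Finite := by
      intro j hj
      refine finite_zeros_of_analyticOnNhd (analyticOnNhd_iteratedDeriv hh _) fun h0 => hne ?_
      have := iteratedDeriv_eqOn_zero_add hab' hh h0 (n - j)
      rwa [show j + 1 + (n - j) = n + 1 by have := Set.mem_Iic.1 hj; omega] at this
    refine ((Set.finite_Iic n).biUnion hj).subset ?_
    rintro x ⟨hx, j, hjn, h0⟩
    exact Set.mem_biUnion (Set.mem_Iic.2 hjn) ⟨hx, h0⟩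
  have huan : AnalyticOnNhd ℝ u (Set.Icc a b) := analyticOnNhd_iteratedDeriv hf _
  have hvan : AnalyticOnNhd ℝ v (Set.Icc a b) := analyticOnNhd_iteratedDeriv hg _
  have hWfin : {x ∈ Set.Icc a b | deriv v x * u x - v x * deriv u x = 0}.Finite := by
    refine finite_zeros_of_analyticOnNhd ((hvan.deriv.mul huan).sub (hvan.mul huan.deriv))
      fun hW => ?_
    obtain ⟨l, hl⟩ := exists_eqOn_mul_of_wronskian hab' huan hvan hu0 hW
    exact one_ne_zero (hpair (-l) 1 fun x hx => by rw [hl hx]; ring).2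
  refine ⟨((hfin f hf hu0).union ((hfin g hg hv0).union hWfin)).toFinset, fun J hJ hJI hJZ => ?_⟩
  simp only [Set.Finite.mem_toFinset, Set.mem_union, not_or] at hJZ
  have hF0 : ∀ j ≤ n, ∀ x ∈ J, iteratedDeriv (j + 1) f x ≠ 0 := fun j hj x hx h0 =>
    (hJZ x hx).1 ⟨hJI hx, j, hj, h0⟩
  have hG0 : ∀ j ≤ n, ∀ x ∈ J, iteratedDeriv (j + 1) g x ≠ 0 := fun j hj x hx h0 =>
    (hJZ x hx).2.1 ⟨hJI hx, j, hj, h0⟩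
  have h := differenceRegular_of_hasDerivAt n (fun j => iteratedDeriv j f)
    (fun j => iteratedDeriv j g) J hJ (fun j x hx => hasDerivAt_iteratedDeriv hf j (hJI hx))
    (fun j x hx => hasDerivAt_iteratedDeriv hg j (hJI hx)) hF0 hG0
    (strictlyMonotonicOn_of_hasDerivAt hJ
      (f' := fun x => (deriv v x * u x - v x * deriv u x) / u x ^ 2)
      (fun x hx => (hvan x (hJI hx)).differentiableAt.hasDerivAt.div
        (huan x (hJI hx)).differentiableAt.hasDerivAt (hF0 n le_rfl x hx))
      fun x hx => div_ne_zero (fun h0 => (hJZ x hx).2.2 ⟨hJI hx, h0⟩)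
        (pow_ne_zero 2 (hF0 n le_rfl x hx)))
  simpa only [iteratedDeriv_zero] using h

theorem balancedSumset_mono (n : ℕ) {X Y : Finset ℝ} (h : X ⊆ Y) :
    balancedSumset n X ⊆ balancedSumset n Y :=
  Finset.sub_subset_sub (Finset.nsmul_subset_nsmul_left h) (Finset.nsmul_subset_nsmul_left h)

theorem KIndependent.exists_card_pow_le {n : ℕ} {a b : ℝ} (hab : a ≤ b) {f g : ℝ → ℝ}
    (hfg : KIndependent (n + 1) (Set.Icc a b) ![f, g]) :
    ∃ c : ℝ, 0 < c ∧ ∀ A : Finset ℝ, ↑A ⊆ Set.Icc a b → A.Nonempty →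
      c * (A.card : ℝ) ^ (5 * 2 ^ n - 2) ≤
        (balancedSumset (n + 1) (A.image f)).card * (balancedSumset (n + 1) (A.image g)).card *
          ((A + A - A).card : ℝ) ^ (5 * 2 ^ n - 2 * (n + 1) - 3) := by
  obtain ⟨Z, hZ⟩ := hfg.exists_finset_differenceRegular hab
  obtain ⟨c, hc, H⟩ := DifferenceRegular.exists_card_pow_le n
  set e := 5 * 2 ^ n - 2
  set C : ℝ := ((Z.card : ℝ) + 1) ^ 2 with hC
  have hC0 : 0 < C := by positivity
  -- The `1` covers `A ⊆ Z`, where `|A| ≤ C` and every factor on the right is at least `1`; `C ^ e`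
  -- pays for shrinking `A` to one interval.
  refine ⟨min 1 c / C ^ e, by positivity, fun A hA hne => ?_⟩
  have hcard : ∀ B : Finset ℝ, B.Nonempty → (1 : ℝ) ≤ (balancedSumset (n + 1) B).card := by
    intro B hB
    exact_mod_cast (Finset.one_le_card.2 hB).trans
      ((card_le_clippedCard _ B).trans (clippedCard_le _ B))
  rcases (A \ Z).eq_empty_or_nonempty with hAZ | hAZ
  · have h1 : (A.card : ℝ) ≤ C := by
      have h2 : (A.card : ℝ) ≤ Z.card := by
        exact_mod_cast Finset.card_le_card (Finset.sdiff_eq_empty_iff_subset.1 hAZ)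
      rw [hC]
      nlinarith [Nat.cast_nonneg (α := ℝ) Z.card]
    have hT : (1 : ℝ) ≤ ((A + A - A).card : ℝ) := by
      exact_mod_cast Finset.one_le_card.2 ((hne.add hne).sub hne)
    calc min 1 c / C ^ e * (A.card : ℝ) ^ e ≤ 1 / C ^ e * C ^ e := by
          gcongr; exact min_le_left _ _
      _ = 1 := by field_simp
      _ ≤ _ := one_le_mul_of_one_le_of_one_le (one_le_mul_of_one_le_of_one_le
          (hcard _ (hne.image f)) (hcard _ (hne.image g))) (one_le_pow₀ hT)
  · obtain ⟨J, A', hJ, hJI, hJZ, hA'A, hA'J, hA'ne, hA'c⟩ :=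
      exists_subinterval_avoiding Set.ordConnected_Icc Z A hA hAZ
    have h1 := H f g J A' (hZ J hJ hJI hJZ) hA'J hA'ne
    have h2 : (A.card : ℝ) ≤ C * A'.card := by rw [hC]; exact_mod_cast hA'c
    have hle : ∀ h : ℝ → ℝ, clippedCard (n + 1) (A'.image h) ≤
        (balancedSumset (n + 1) (A.image h)).card := fun h =>
      (clippedCard_le _ _).trans (Finset.card_le_card
        (balancedSumset_mono _ (Finset.image_subset_image hA'A)))
    calc min 1 c / C ^ e * (A.card : ℝ) ^ e ≤ c / C ^ e * (C * A'.card) ^ e := by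
          gcongr; exact min_le_right _ _
      _ = c * (A'.card : ℝ) ^ e := by rw [mul_pow]; field_simp
      _ ≤ _ := h1
      _ ≤ _ := by
          gcongr
          · exact hle f
          · exact hle g

/- For `1 ≤ k` no natural number subtraction in the exponents is truncated. -/
theorem theorem1p5 (k : ℕ) (hk : 1 ≤ k) (a b : ℝ) (hab : a ≤ b) (f g : ℝ → ℝ)
    (hfg : KIndependent k (Set.Icc a b) ![f, g]) :
    ∃ c : ℝ, 0 < c ∧ ∀ A : Finset ℝ, (∀ x ∈ A, x ∈ Set.Icc a b) →
      ∀ K : ℝ, ((A + A - A).card : ℝ) = K * (A.card : ℝ) →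
        c * ((A.card : ℝ) ^ (5 * 2 ^ (k - 1) - 2) /
            ((A + A - A).card : ℝ) ^ (5 * 2 ^ (k - 1) - 2 * k - 3)) ≤
          ((iteratedSumset (2 ^ k) (A.image f) -
              iteratedSumset (2 ^ k - 1) (A.image f)).card : ℝ) *
            ((iteratedSumset (2 ^ k) (A.image g) -
              iteratedSumset (2 ^ k - 1) (A.image g)).card : ℝ) ∧
        (A.card : ℝ) ^ (5 * 2 ^ (k - 1) - 2) /
            ((A + A - A).card : ℝ) ^ (5 * 2 ^ (k - 1) - 2 * k - 3) =
          (A.card : ℝ) ^ (2 * k + 1) / K ^ (5 * 2 ^ (k - 1) - 2 * k - 3) := by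
  obtain ⟨n, rfl⟩ : ∃ n, k = n + 1 := ⟨k - 1, by omega⟩
  obtain ⟨c, hc, H⟩ := hfg.exists_card_pow_le hab
  have hexp : 2 * (n + 1) + 3 ≤ 5 * 2 ^ n := by
    have := Nat.lt_two_pow_self (n := n)
    omega
  simp only [Nat.add_sub_cancel, iteratedSumset_eq_nsmul]
  refine ⟨c, hc, fun A hA K hK => ?_⟩
  rcases A.eq_empty_or_nonempty with rfl | hne
  · have h1 : 5 * 2 ^ n - 2 ≠ 0 := by omega
    refine ⟨?_, ?_⟩
    · rw [Finset.card_empty, Nat.cast_zero, zero_pow h1, zero_div, mul_zero]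
      positivity
    · rw [Finset.card_empty, Nat.cast_zero, zero_pow h1, zero_div, zero_pow (by omega), zero_div]
  · have hT : (0 : ℝ) < ((A + A - A).card : ℝ) := by
      exact_mod_cast ((hne.add hne).sub hne).card_pos
    have hN : (0 : ℝ) < (A.card : ℝ) := by exact_mod_cast hne.card_pos
    refine ⟨?_, ?_⟩
    · rw [← mul_div_assoc, div_le_iff₀ (by positivity)]
      exact H A hA hne
    · have hK0 : K ≠ 0 := by
        rintro rfl
        rw [zero_mul] at hK
        exact hT.ne' hK
      rw [hK, mul_pow, show 5 * 2 ^ n - 2 = (5 * 2 ^ n - 2 * (n + 1) - 3) + (2 * (n + 1) + 1) by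
        omega, pow_add]
      field_simp
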